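/- Let $F$ be a real vector lattice. An ideal of $F$ is a linear subspace $H\subseteq F$ that is solid, i.e. $|y|\le|x|$ and $x\in H$ imply $y\in H$. For an ideal $H$ put $H^d=\{f\in F:\ |f|\wedge|h|=0 \text{ for all } h\in H\}$; $H$ is called a projection band if $F=H+H^d$. The set $\mathcal I_F$ of all ideals of $F$, ordered by inclusion, is a complete lattice in which the join of $H$ and $J$ is $H+J$ and the meet of a family is its intersection (the meet of the empty family being $F$). Call $\mathcal I_F$ infinite-meet distributive at $H\in\mathcal I_F$ if $$\bigcap_{J\in\mathcal J}(H+J)=H+\bigcap\mathcal J\qquad\text{for every } \mathcal J\subseteq\mathcal I_F .$$ Theorem. Let $H$ be an ideal of a real vector lattice $F$. (a) If $H$ is a projection band, then $\mathcal I_F$ is infinite-meet distributive at $H$. (b) If $F$ is Archimedean, i.e. $\bigwedge_{n\ge1}\frac1n f=0$ for every $f\ge0$ in $F$, then $H$ is a projection band if and only if $\mathcal I_F$ is infinite-meet distributive at $H$. -/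

import Mathlib

open scoped Pointwise

section VectorLattices

/-! A (real) vector lattice is a real vector space `F` with a lattice order such that translations
and multiplications by nonnegative scalars are monotone, that is,
`[AddCommGroup F] [Lattice F] [IsOrderedAddMonoid F] [Module ℝ F] [IsOrderedModule ℝ F]`. -/

/-- A vector lattice is Archimedean if `⋀ₙ (1/n) f = 0` for every `f ≥ 0`. -/
def IsArchimedeanVL (F : Type*) [AddCommGroup F] [Lattice F] [Module ℝ F] : Prop :=
  ∀ f : F, 0 ≤ f → IsGLB (Set.range fun n : ℕ => (1 / ((n : ℝ) + 1)) • f) 0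

/-- An ideal of a vector lattice: a linear subspace which is solid, i.e. `|y| ≤ |x|` and
`x ∈ H` imply `y ∈ H`. -/
structure VLIdeal (F : Type*) [AddCommGroup F] [Lattice F] [Module ℝ F]
    extends Submodule ℝ F where
  solid' : LatticeOrderedAddCommGroup.IsSolid carrier

/-- The disjoint complement `Gᵈ = {f : |f| ∧ |g| = 0 for all g ∈ G}`. -/
def disjointCompl {F : Type*} [AddCommGroup F] [Lattice F] (G : Set F) : Set F :=
  {f | ∀ g ∈ G, |f| ⊓ |g| = 0}

/-- An element `h` of a complete lattice `L` is infinite-meet distributive if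
`⋀_{s ∈ S} (h ∨ s) = h ∨ ⋀ S` for every `S ⊆ L`. -/
def IsInfiniteMeetDistributiveAt {L : Type*} [CompleteLattice L] (h : L) : Prop :=
  ∀ S : Set L, ⨅ s ∈ S, (h ⊔ s) = h ⊔ sInf S

namespace VLIdeal

variable {F : Type*} [AddCommGroup F] [Lattice F] [Module ℝ F]

instance : SetLike (VLIdeal F) F where
  coe H := H.carrier
  coe_injective := by
    rintro ⟨H, hH⟩ ⟨J, hJ⟩ h
    have : H = J := SetLike.coe_injective h
    subst this
    rfl

/-- Ideals are ordered by inclusion. -/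
instance : PartialOrder (VLIdeal F) := PartialOrder.ofSetLike (VLIdeal F) F

theorem solid (H : VLIdeal F) {x y : F} (hx : x ∈ H) (h : |y| ≤ |x|) : y ∈ H :=
  H.solid' hx h

/-- An ideal `H` is a projection band if `F = H + Hᵈ`. -/
def IsProjectionBand (H : VLIdeal F) : Prop :=
  (H : Set F) + disjointCompl (H : Set F) = Set.univ

/-- The infimum of a family of ideals is its intersection (`F` for the empty family). -/
instance : InfSet (VLIdeal F) where
  sInf S :=
    { carrier := ⋂ J ∈ S, (J : Set F)
      add_mem' := fun ha hb => Set.mem_iInter₂.2 fun J hJ =>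
        J.add_mem' (Set.mem_iInter₂.1 ha J hJ) (Set.mem_iInter₂.1 hb J hJ)
      zero_mem' := Set.mem_iInter₂.2 fun J _ => J.zero_mem'
      smul_mem' := fun c _ hx => Set.mem_iInter₂.2 fun J hJ =>
        J.smul_mem' c (Set.mem_iInter₂.1 hx J hJ)
      solid' := fun _ hx _ hy => Set.mem_iInter₂.2 fun J hJ =>
        J.solid' (Set.mem_iInter₂.1 hx J hJ) hy }

theorem coe_sInf (S : Set (VLIdeal F)) : ((sInf S : VLIdeal F) : Set F) = ⋂ J ∈ S, (J : Set F) :=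
  rfl

/-- The meet of two ideals is their intersection. -/
instance : Min (VLIdeal F) where
  min H J :=
    { H.toSubmodule ⊓ J.toSubmodule with
      solid' := fun _ hx _ hy => ⟨H.solid' hx.1 hy, J.solid' hx.2 hy⟩ }

/-- The greatest ideal is `F`. -/
instance : Top (VLIdeal F) where
  top := { (⊤ : Submodule ℝ F) with solid' := fun _ _ _ _ => trivial }

variable [IsOrderedAddMonoid F]

/-- The least ideal is `{0}`. -/
instance : Bot (VLIdeal F) where
  bot :=
    { (⊥ : Submodule ℝ F) with
      solid' := by
        intro x hx y hy
        have hx0 : x = 0 := hx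
        have h0 : |y| ≤ 0 := by simpa [hx0] using hy
        have hy0 : y = 0 := by
          have h1 : y ≤ 0 := (le_abs_self y).trans h0
          have h2 : -y ≤ 0 := (neg_le_abs y).trans h0
          exact le_antisymm h1 (neg_nonpos.1 h2)
        exact hy0 }

/-- The join of two ideals is their sum `H + J`. -/
instance : Max (VLIdeal F) where
  max H J :=
    { carrier := (H : Set F) + (J : Set F)
      add_mem' := by
        rintro _ _ ⟨a, ha, b, hb, rfl⟩ ⟨c, hc, d, hd, rfl⟩
        exact ⟨a + c, H.add_mem' ha hc, b + d, J.add_mem' hb hd, add_add_add_comm a c b d⟩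
      zero_mem' := ⟨0, H.zero_mem', 0, J.zero_mem', add_zero 0⟩
      smul_mem' := by
        rintro r _ ⟨a, ha, b, hb, rfl⟩
        exact ⟨r • a, H.smul_mem' r ha, r • b, J.smul_mem' r hb, (smul_add r a b).symm⟩
      solid' := by
        rintro _ ⟨a, ha, b, hb, rfl⟩ y hy
        have hab : |y| ≤ |a| + |b| := hy.trans (abs_add_le a b)
        have hy1 : y ≤ |a| + |b| := (le_abs_self y).trans hab
        have hy2 : -y ≤ |a| + |b| := (neg_le_abs y).trans hab
        have hy3 : -(|a| + |b|) ≤ y := neg_le.1 hy2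
        have hb0 : 0 ≤ |b| := abs_nonneg b
        have ha0 : 0 ≤ |a| := abs_nonneg a
        refine ⟨(y ⊓ |a|) ⊔ -|a|, H.solid' ha ?_, y - ((y ⊓ |a|) ⊔ -|a|), J.solid' hb ?_,
          add_sub_cancel _ _⟩
        · refine abs_le'.2 ⟨sup_le inf_le_right ((neg_nonpos.2 ha0).trans ha0), ?_⟩
          exact neg_le.1 le_sup_right
        · refine abs_le'.2 ⟨?_, ?_⟩
          · refine sub_le_comm.1 (le_trans (le_inf ?_ ?_) le_sup_left)
            · exact sub_le_self y hb0
            · exact sub_le_iff_le_add.2 hy1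
          · rw [neg_sub]
            refine sub_le_iff_le_add.2 (sup_le ?_ ?_)
            · exact inf_le_left.trans (le_add_of_nonneg_left hb0)
            · rw [neg_add, ← sub_eq_add_neg] at hy3
              exact sub_le_iff_le_add'.1 hy3 }

theorem coe_sup (H J : VLIdeal F) : ((H ⊔ J : VLIdeal F) : Set F) = (H : Set F) + (J : Set F) :=
  rfl

/-- The lattice of all ideals of `F`, ordered by inclusion: joins are sums and
meets are intersections. -/
instance : CompleteLattice (VLIdeal F) :=
  { completeLatticeOfInf (VLIdeal F) (fun S =>
      ⟨fun J hJ x hx => Set.mem_iInter₂.1 hx J hJ,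
       fun J hJ x hx => Set.mem_iInter₂.2 fun K hK => hJ hK hx⟩) with
    le := (· ≤ ·)
    lt := (· < ·)
    sInf := sInf
    sup := max
    le_sup_left := fun _ J x hx => ⟨x, hx, 0, J.zero_mem', add_zero x⟩
    le_sup_right := fun H _ x hx => ⟨0, H.zero_mem', x, hx, zero_add x⟩
    sup_le := by
      rintro H J K hH hJ _ ⟨a, ha, b, hb, rfl⟩
      exact K.add_mem' (hH ha) (hJ hb)
    inf := min
    inf_le_left := fun _ _ _ hx => hx.1
    inf_le_right := fun _ _ _ hx => hx.2
    le_inf := fun _ _ _ h1 h2 _ hx => ⟨h1 hx, h2 hx⟩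
    top := ⊤
    le_top := fun _ _ _ => trivial
    bot := ⊥
    bot_le := by
      intro H x hx
      have hx0 : x = 0 := hx
      subst hx0
      exact H.zero_mem' }

/-- In the lattice of ideals, infinite-meet distributivity at `H` reads
`⋂_{J ∈ 𝒥} (H + J) = H + ⋂ 𝒥` for every set `𝒥` of ideals. -/
theorem isInfiniteMeetDistributiveAt_iff (H : VLIdeal F) :
    IsInfiniteMeetDistributiveAt H ↔ ∀ 𝒥 : Set (VLIdeal F),
      ⋂ J ∈ 𝒥, ((H : Set F) + (J : Set F)) = (H : Set F) + ⋂ J ∈ 𝒥, (J : Set F) := by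
  refine forall_congr' fun S => ?_
  rw [← SetLike.coe_set_eq, ← sInf_image, coe_sInf, coe_sup, coe_sInf, Set.biInter_image]
  rfl

end VLIdeal

end VectorLattices

section VectorLatticeLemmas

variable {F : Type*} [AddCommGroup F] [Lattice F] [IsOrderedAddMonoid F]

/-! If `f = a + b` with `a ∈ H` and `b ∈ Hᵈ`, then `f ∈ H + J` forces `b ∈ J`, so one decomposition
serves every `J` at once. Conversely, distributivity over all `J` with `f ∈ H + J` gives `f = h +
j`, where `h ∈ H` and `j` lies in every such `J`. To see `j ∈ Hᵈ`, take `g ∈ H`, `ε > 0` and the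
ideal `P` generated by `(ε|j| - |g|)⁺`. Modulo `H`, `P` still captures `j`, so `f ∈ H + P` and hence
`j ∈ P`. This forces `|j| ⊓ |g| ≤ ε|j|`, and the Archimedean property finishes. -/

theorem inf_add_le_inf_add_inf {a b c : F} (ha : 0 ≤ a) (hb : 0 ≤ b) (hc : 0 ≤ c) :
    a ⊓ (b + c) ≤ a ⊓ b + a ⊓ c := by
  rw [inf_add, add_inf, add_inf]
  exact le_inf (le_inf (inf_le_left.trans (le_add_of_nonneg_left ha))
      (inf_le_left.trans (le_add_of_nonneg_right hc)))
    (le_inf (inf_le_left.trans (le_add_of_nonneg_left hb)) inf_le_right)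

variable [Module ℝ F] [IsOrderedModule ℝ F]

omit [IsOrderedAddMonoid F] in
theorem abs_smul_le_abs_smul_abs (r : ℝ) (x : F) : |r • x| ≤ |r| • |x| := by
  rcases le_total 0 r with hr | hr
  · rw [abs_of_nonneg hr]
    refine abs_le'.2 ⟨smul_le_smul_of_nonneg_left (le_abs_self x) hr, ?_⟩
    rw [← smul_neg]
    exact smul_le_smul_of_nonneg_left (neg_le_abs x) hr
  · rw [abs_of_nonpos hr]
    have hr' : 0 ≤ -r := neg_nonneg.2 hr
    refine abs_le'.2 ⟨?_, ?_⟩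
    · rw [← neg_smul_neg]
      exact smul_le_smul_of_nonneg_left (neg_le_abs x) hr'
    · rw [← neg_smul]
      exact smul_le_smul_of_nonneg_left (le_abs_self x) hr'

/-- If `v` and `w` are disjoint, then so are `v` and `c • w`. -/
theorem nonpos_of_le_of_le_smul {v w z : F} (hvw : v ⊓ w = 0) (hz : 0 ≤ z) (hzv : z ≤ v)
    {c : ℝ} (hzw : z ≤ c • w) : z ≤ 0 := by
  have hw : 0 ≤ w := hvw ▸ inf_le_right
  -- `c` may be nonpositive; `max c 1` is invertible with inverse at most `1`, so the rescaled `z`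
  -- stays below both `v` and `w`.
  have hd1 : 1 ≤ max c 1 := le_max_right c 1
  have hd : 0 < max c 1 := one_pos.trans_le hd1
  have h1 : (max c 1)⁻¹ • z ≤ v := by
    refine le_trans ?_ hzv
    simpa using smul_le_smul_of_nonneg_right (inv_le_one_of_one_le₀ hd1) hz
  have h2 : (max c 1)⁻¹ • z ≤ w := by
    have := smul_le_smul_of_nonneg_left
      (hzw.trans (smul_le_smul_of_nonneg_right (le_max_left c 1) hw)) (inv_nonneg.2 hd.le)
    rwa [inv_smul_smul₀ hd.ne'] at this
  have h3 := smul_le_smul_of_nonneg_left ((le_inf h1 h2).trans hvw.le) hd.le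
  rwa [smul_inv_smul₀ hd.ne', smul_zero] at h3

namespace VLIdeal

omit [IsOrderedModule ℝ F] in
theorem mem_of_abs_mem {H : VLIdeal F} {x : F} (hx : |x| ∈ H) : x ∈ H :=
  H.solid hx (abs_abs x).ge

/-- The ideal generated by one element. -/
def principal (x : F) : VLIdeal F where
  carrier := {y | ∃ c : ℝ, |y| ≤ c • |x|}
  add_mem' := by
    rintro a b ⟨c, hc⟩ ⟨d, hd⟩
    exact ⟨c + d, (abs_add_le a b).trans ((add_le_add hc hd).trans_eq (add_smul c d |x|).symm)⟩
  zero_mem' := ⟨0, by simp⟩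
  smul_mem' := by
    rintro r a ⟨c, hc⟩
    refine ⟨|r| * c, (abs_smul_le_abs_smul_abs r a).trans ?_⟩
    rw [mul_smul]
    exact smul_le_smul_of_nonneg_left hc (abs_nonneg r)
  solid' := fun _ ⟨c, hc⟩ _ hy => ⟨c, hy.trans hc⟩

theorem mem_principal {x y : F} : y ∈ principal x ↔ ∃ c : ℝ, |y| ≤ c • |x| :=
  Iff.rfl

theorem self_mem_principal (x : F) : x ∈ principal x :=
  ⟨1, (one_smul ℝ |x|).ge⟩

omit [IsOrderedModule ℝ F] in
/-- An element of `Hᵈ` that lies in `H + J` lies in `J`. -/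
theorem mem_of_mem_disjointCompl_of_mem_sup {H J : VLIdeal F} {b : F}
    (hb : b ∈ disjointCompl (H : Set F)) (hbJ : b ∈ H ⊔ J) : b ∈ J := by
  obtain ⟨h, hh, j, hj, rfl⟩ := hbJ
  refine J.solid hj ?_
  have h1 : |h + j| ≤ |h + j| ⊓ (|h| + |j|) := le_inf le_rfl (abs_add_le h j)
  have h2 := h1.trans (inf_add_le_inf_add_inf (abs_nonneg _) (abs_nonneg h) (abs_nonneg j))
  rw [hb h hh, zero_add] at h2
  exact h2.trans inf_le_right

omit [IsOrderedModule ℝ F] in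
theorem IsProjectionBand.isInfiniteMeetDistributiveAt {H : VLIdeal F}
    (hH : H.IsProjectionBand) : IsInfiniteMeetDistributiveAt H := by
  rw [isInfiniteMeetDistributiveAt_iff]
  intro 𝒥
  refine Set.Subset.antisymm (fun f hf => ?_) ?_
  · obtain ⟨a, ha, b, hb, rfl⟩ : f ∈ (H : Set F) + disjointCompl (H : Set F) :=
      Set.eq_univ_iff_forall.1 hH f
    refine ⟨a, ha, b, Set.mem_iInter₂.2 fun J hJ =>
      mem_of_mem_disjointCompl_of_mem_sup hb ?_, rfl⟩
    obtain ⟨h, hh, j, hj, hhj⟩ := Set.mem_iInter₂.1 hf J hJ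
    refine ⟨-a + h, H.add_mem' (H.toSubmodule.neg_mem ha) hh, j, hj, ?_⟩
    change -a + h + j = b
    rw [add_assoc, show h + j = a + b from hhj, neg_add_cancel_left]
  · rintro _ ⟨h, hh, j, hj, rfl⟩
    exact Set.mem_iInter₂.2 fun J hJ => ⟨h, hh, j, Set.mem_iInter₂.1 hj J hJ, rfl⟩

/-- Since `ε|j| = (ε|j| ⊓ |g|) + (ε|j| - |g|)⁺` and the first summand is in `H` by solidity, cutting
off `|g|` loses nothing modulo `H`. -/
theorem mem_sup_principal_posPart {H : VLIdeal F} {j g : F} (hg : g ∈ H) {ε : ℝ} (hε : 0 < ε) :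
    j ∈ H ⊔ principal (ε • |j| - |g|)⁺ := by
  have hεj : 0 ≤ ε • |j| := smul_nonneg hε.le (abs_nonneg j)
  have hinf : ε • |j| ⊓ |g| ∈ H := by
    refine H.solid hg ?_
    rw [abs_of_nonneg (le_inf hεj (abs_nonneg g))]
    exact inf_le_right
  have hmem : ε • |j| ∈ H ⊔ principal (ε • |j| - |g|)⁺ := by
    refine ⟨_, hinf, _, self_mem_principal _, ?_⟩
    change ε • |j| ⊓ |g| + (ε • |j| - |g|)⁺ = ε • |j|
    rw [posPart_def, ← sub_self |g|, ← sup_sub, add_sub, inf_add_sup, add_sub_cancel_right]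
  have := (H ⊔ principal (ε • |j| - |g|)⁺).smul_mem' ε⁻¹ hmem
  rw [inv_smul_smul₀ hε.ne'] at this
  exact mem_of_abs_mem this

/-- The element `(|j| ⊓ |g| - ε|j|)⁺` lies below `(ε|j| - |g|)⁻` and below `|j|`, hence below a
multiple of `(ε|j| - |g|)⁺`. Positive and negative parts are disjoint, so it vanishes. -/
theorem abs_inf_abs_le_smul_abs {j g : F} {ε : ℝ} (hε : 0 ≤ ε)
    (hj : j ∈ principal (ε • |j| - |g|)⁺) : |j| ⊓ |g| ≤ ε • |j| := by
  obtain ⟨c, hc⟩ := mem_principal.1 hj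
  rw [abs_of_nonneg (posPart_nonneg _)] at hc
  have hεj : 0 ≤ ε • |j| := smul_nonneg hε (abs_nonneg j)
  have hdisj : (ε • |j| - |g|)⁻ ⊓ (ε • |j| - |g|)⁺ = 0 := by
    rw [inf_comm, posPart_inf_negPart_eq_zero]
  have hle : (|j| ⊓ |g| - ε • |j|)⁺ ≤ (ε • |j| - |g|)⁻ := by
    rw [← posPart_neg, neg_sub]
    exact posPart_mono (sub_le_sub_right inf_le_right _)
  have hle' : (|j| ⊓ |g| - ε • |j|)⁺ ≤ |j| :=
    sup_le ((sub_le_self _ hεj).trans inf_le_left) (abs_nonneg j)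
  have := nonpos_of_le_of_le_smul hdisj (posPart_nonneg _) hle (hle'.trans hc)
  exact sub_nonpos.1 ((le_posPart _).trans this)

theorem isProjectionBand_of_isInfiniteMeetDistributiveAt (hF : IsArchimedeanVL F) {H : VLIdeal F}
    (hH : IsInfiniteMeetDistributiveAt H) : H.IsProjectionBand := by
  refine Set.eq_univ_iff_forall.2 fun f => ?_
  -- With this family, `f` lies in the left-hand intersection by definition.
  have hf := (H.isInfiniteMeetDistributiveAt_iff.1 hH {J | f ∈ H ⊔ J}).subset
    (Set.mem_iInter₂.2 fun J hJ => hJ)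
  obtain ⟨h, hh, j, hj, rfl⟩ := hf
  refine ⟨h, hh, j, fun g hg => le_antisymm ?_ (le_inf (abs_nonneg j) (abs_nonneg g)), rfl⟩
  refine (hF |j| (abs_nonneg j)).2 ?_
  rintro _ ⟨n, rfl⟩
  have hε : (0 : ℝ) < 1 / ((n : ℝ) + 1) := Nat.one_div_pos_of_nat
  -- It remains to place the principal ideal in the family: `h ∈ H` and `j ∈ H + P` give `h + j ∈ H
  -- + P`.
  refine abs_inf_abs_le_smul_abs hε.le (Set.mem_iInter₂.1 hj _ ?_)
  obtain ⟨a, ha, b, hb, hab⟩ := mem_sup_principal_posPart (j := j) hg hε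
  exact ⟨h + a, H.add_mem' hh ha, b, hb, (add_assoc h a b).trans (congrArg (h + ·) hab)⟩

end VLIdeal

end VectorLatticeLemmas

/-- Let `F` be a vector lattice and `H` an ideal of `F`. If `H` is a projection band, then the
lattice of ideals of `F` is infinite-meet distributive at `H`, i.e.
`⋂_{J ∈ 𝒥} (H + J) = H + ⋂ 𝒥` for every family `𝒥` of ideals; and if `F` is Archimedean, then
the two properties are equivalent. -/
theorem theorem3p5 {F : Type*} [AddCommGroup F] [Lattice F] [IsOrderedAddMonoid F]
    [Module ℝ F] [IsOrderedModule ℝ F] (H : VLIdeal F) :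
    (H.IsProjectionBand → IsInfiniteMeetDistributiveAt H) ∧
      (IsArchimedeanVL F → (H.IsProjectionBand ↔ IsInfiniteMeetDistributiveAt H)) := by
  exact ⟨fun h => h.isInfiniteMeetDistributiveAt, fun hF =>
    ⟨fun h => h.isInfiniteMeetDistributiveAt,
      VLIdeal.isProjectionBand_of_isInfiniteMeetDistributiveAt hF⟩⟩
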